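/- For $k\ge 1$ let $\mathcal A_k(z)$ be the partition algebra over $\mathbb Z[z]$, $z$ an indeterminate: it is the free $\mathbb Z[z]$-module on the set partitions (diagrams) of $\{1,\dots,k,1',\dots,k'\}$, with product $\rho_1\rho_2=z^{\ell}\,\rho_1\circ\rho_2$, where $\rho_1\circ\rho_2$ is obtained by placing $\rho_1$ above $\rho_2$, identifying the bottom row of $\rho_1$ with the top row of $\rho_2$ and deleting the components contained in the middle row, and $\ell$ is the number of deleted components. Let $s_i,\ p_{i+\frac12}$ ($1\le i\le k-1$) and $p_j$ ($1\le j\le k$) be the diagrams in which all columns not named are vertical blocks $\{m,m'\}$ and: $s_i$ has the blocks $\{i,(i+1)'\},\{i+1,i'\}$; $p_{i+\frac12}$ has the block $\{i,i+1,i',(i+1)'\}$; $p_j$ has the blocks $\{j\},\{j'\}$. Define $L_i,\sigma_i$ by $L_0=0$, $L_1=p_1$, $\sigma_1=1$, $\sigma_2=s_1$, $$L_{i+1}=-s_iL_ip_{i+\frac12}-p_{i+\frac12}L_is_i+p_{i+\frac12}L_ip_{i+1}p_{i+\frac12}+s_iL_is_i+\sigma_{i+1}\qquad(i\ge1),$$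 $$\begin{aligned}\sigma_{i+1}={}&s_{i-1}s_i\sigma_is_is_{i-1}+s_ip_{i-\frac12}L_{i-1}s_ip_{i-\frac12}s_i+p_{i-\frac12}L_{i-1}s_ip_{i-\frac12}\\&-s_ip_{i-\frac12}L_{i-1}s_{i-1}p_{i+\frac12}p_ip_{i-\frac12}-p_{i-\frac12}p_ip_{i+\frac12}s_{i-1}L_{i-1}p_{i-\frac12}s_i\qquad(i\ge2),\end{aligned}$$ and $L_{i+\frac12},\sigma_{i+\frac12}$ by $L_{\frac12}=0$, $\sigma_{\frac12}=\sigma_{1+\frac12}=1$, $$L_{i+\frac12}=-L_ip_{i+\frac12}-p_{i+\frac12}L_i+p_{i+\frac12}L_ip_ip_{i+\frac12}+s_iL_{i-\frac12}s_i+\sigma_{i+\frac12}\qquad(i\ge1),$$ $$\begin{aligned}\sigma_{i+\frac12}={}&s_{i-1}s_i\sigma_{i-\frac12}s_is_{i-1}+p_{i-\frac12}L_{i-1}s_ip_{i-\frac12}s_i+s_ip_{i-\frac12}L_{i-1}s_ip_{i-\frac12}\\&-p_{i-\frac12}L_{i-1}s_{i-1}p_{i+\frac12}p_ip_{i-\frac12}-s_ip_{i-\frac12}p_ip_{i+\frac12}s_{i-1}L_{i-1}p_{i-\frac12}s_i\qquad(i\ge2).\end{aligned}$$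 Then for every $i\ge 1$ and every $k\ge i+1$ the following hold in $\mathcal A_k(z)$: 1. $p_{i+1}\sigma_{i+1}p_{i+1}=L_ip_{i+1}$; 2. $p_{i+1}\sigma_{i+\frac12}p_{i+1}=(z-L_{i-\frac12})p_{i+1}$; 3. $p_{i+\frac32}\sigma_{i+1}p_{i+\frac32}=p_{i+\frac12}p_{i+\frac32}$, provided $k\ge i+2$ (so that $p_{i+\frac32}$ is defined); 4. $L_{i+\frac12}=-L_ip_{i+\frac12}-p_{i+\frac12}L_i+(z-L_{i-\frac12})p_{i+\frac12}+s_iL_{i-\frac12}s_i+\sigma_{i+\frac12}$. -/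

import Mathlib

open Polynomial

/-- A partition diagram on `k` columns: a set partition (equivalence relation) of the `2k` vertices
`1, …, k` (top row, `Sum.inl`) and `1', …, k'` (bottom row, `Sum.inr`).
The vertex with number `j` is the element of `Fin k` whose value is `j - 1`. -/
abbrev PartitionDiagram (k : ℕ) : Type := Setoid (Fin k ⊕ Fin k)

namespace PartitionDiagram

/-- The vertices of two stacked diagrams: top row, middle row, bottom row. -/
abbrev Rows (k : ℕ) : Type := Fin k ⊕ (Fin k ⊕ Fin k)

/-- Placement of the vertices of the upper diagram: top row and middle row. -/
def upper (k : ℕ) : Fin k ⊕ Fin k → Rows k := Sum.map id Sum.inl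

/-- Placement of the vertices of the lower diagram: middle row and bottom row. -/
def lower (k : ℕ) : Fin k ⊕ Fin k → Rows k := Sum.inr

/-- The outer vertices of the stacked diagram: top row and bottom row. -/
def outer (k : ℕ) : Fin k ⊕ Fin k → Rows k := Sum.map id Sum.inr

/-- `a` placed above `b`, the bottom row of `a` being identified with the top row of `b`:
the equivalence relation on three rows generated by the two diagrams. -/
def stack {k : ℕ} (a b : PartitionDiagram k) : Setoid (Rows k) :=
  Setoid.map a (upper k) ⊔ Setoid.map b (lower k)

/-- The composition `a ∘ b`: the stacked diagram restricted to the top and bottom rows. -/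
def comp {k : ℕ} (a b : PartitionDiagram k) : PartitionDiagram k :=
  Setoid.comap (outer k) (stack a b)

/-- The number of blocks of the stacked diagram that contain only vertices of the middle row. -/
noncomputable def loops {k : ℕ} (a b : PartitionDiagram k) : ℕ :=
  Nat.card {c : Quotient (stack a b) // ∀ v, (Quotient.mk (stack a b) (outer k v)) ≠ c}

/-- The identity diagram, with blocks `{j, j'}`. -/
def idDiagram (k : ℕ) : PartitionDiagram k := Setoid.ker (Sum.elim id id)

/-- The diagram of `s_i`: blocks `{i, (i+1)'}`, `{i+1, i'}` and `{j, j'}` for `j ≠ i, i+1`. -/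
def sDiagram (k i : ℕ) : PartitionDiagram k :=
  Setoid.ker (Sum.elim (fun v : Fin k => v.val + 1)
    (fun v : Fin k => Equiv.swap i (i + 1) (v.val + 1)))

/-- The diagram of `p_j`: blocks `{j}`, `{j'}` and `{m, m'}` for `m ≠ j`. -/
def pDiagram (k j : ℕ) : PartitionDiagram k :=
  Setoid.ker (Sum.elim (fun v : Fin k => (Sum.inl v : Fin k ⊕ Fin k))
    (fun v : Fin k => if v.val + 1 = j then Sum.inr v else Sum.inl v))

/-- The diagram of `p_{i+1/2}`: blocks `{i, i+1, i', (i+1)'}` and `{m, m'}` for `m ≠ i, i+1`. -/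
def pHalfDiagram (k i : ℕ) : PartitionDiagram k :=
  Setoid.ker (Sum.elim (fun v : Fin k => if v.val + 1 = i + 1 then i else v.val + 1)
    (fun v : Fin k => if v.val + 1 = i + 1 then i else v.val + 1))

/-! Composition of diagrams is associative and unital, together with the loop counts.
This is shown by counting the colourings of three rows with two colours. -/

/-- The colouring `(t, b)` of top and bottom row is constant on the blocks of `a`. -/
def Compat {k : ℕ} {C : Type*} (a : PartitionDiagram k) (t b : Fin k → C) : Prop :=
  a ≤ Setoid.ker (Sum.elim t b)

open Classical in
/-- The indicator of compatibility. -/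
noncomputable def wt {k : ℕ} {C : Type*} (a : PartitionDiagram k) (t b : Fin k → C) : ℕ :=
  if Compat a t b then 1 else 0

theorem stack_le_ker {k : ℕ} {C : Type*} (a b : PartitionDiagram k) (t m u : Fin k → C) :
    stack a b ≤ Setoid.ker (Sum.elim t (Sum.elim m u)) ↔ Compat a t m ∧ Compat b m u := by
  have key : ∀ (f : Fin k ⊕ Fin k → Rows k) (r : PartitionDiagram k) (s : Setoid (Rows k)),
      Setoid.map r f ≤ s ↔ r ≤ Setoid.comap f s := by
    intro f r s
    constructor
    · intro h x y hxy
      exact h (Relation.EqvGen.rel _ _ ⟨x, y, hxy, rfl, rfl⟩)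
    · intro h
      refine Setoid.eqvGen_le ?_
      rintro x y ⟨x', y', hxy, rfl, rfl⟩
      exact h hxy
  unfold stack Compat
  rw [sup_le_iff, key, key]
  have e1 : Setoid.comap (upper k) (Setoid.ker (Sum.elim t (Sum.elim m u)))
      = Setoid.ker (Sum.elim t m) := by
    ext x y
    rcases x with x | x <;> rcases y with y | y <;>
      simp [Setoid.ker_def, upper]
  have e2 : Setoid.comap (lower k) (Setoid.ker (Sum.elim t (Sum.elim m u)))
      = Setoid.ker (Sum.elim m u) := by
    ext x y
    rcases x with x | x <;> rcases y with y | y <;>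
      simp [Setoid.ker_def, lower]
  rw [e1, e2]

open Classical in
/-- The number of colourings of the middle row that extend a colouring of the outer rows. -/
theorem sum_wt_mul_wt {k : ℕ} {C : Type*} [Fintype C] (a b : PartitionDiagram k)
    (t u : Fin k → C) :
    ∑ m : Fin k → C, wt a t m * wt b m u
      = Fintype.card C ^ loops a b * wt (comp a b) t u := by
  have h1 : ∑ m : Fin k → C, wt a t m * wt b m u
      = Fintype.card {m : Fin k → C // Compat a t m ∧ Compat b m u} := by
    rw [Fintype.card_subtype, Finset.card_filter]
    refine Finset.sum_congr rfl fun m _ => ?_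
    unfold wt
    by_cases h : Compat a t m <;> by_cases h' : Compat b m u <;> simp [h, h']
  rw [h1]
  by_cases hc : Compat (comp a b) t u
  · rw [show wt (comp a b) t u = 1 by simp [wt, hc], mul_one]
    let Q := Quotient (stack a b)
    let P : Q → Prop := fun c => ∀ v, (Quotient.mk (stack a b) (outer k v)) ≠ c
    have hP : ∀ c : Q, ¬ P c → ∃ v, Quotient.mk (stack a b) (outer k v) = c := by
      intro c hc'
      simpa only [P, ne_eq, not_forall, not_not] using hc'
    have hwd : ∀ v w, Quotient.mk (stack a b) (outer k v) = Quotient.mk (stack a b) (outer k w) →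
        Sum.elim t u v = Sum.elim t u w := by
      intro v w hvw
      have h : (stack a b) (outer k v) (outer k w) := Quotient.exact hvw
      exact hc h
    let ext : ({c : Q // P c} → C) → Q → C := fun g c =>
      if h : P c then g ⟨c, h⟩ else Sum.elim t u (hP c h).choose
    have ext_outer : ∀ g v, ext g (Quotient.mk _ (outer k v)) = Sum.elim t u v := by
      intro g v
      have hn : ¬ P (Quotient.mk _ (outer k v)) := fun h => h v rfl
      simp only [ext, dif_neg hn]
      exact hwd _ _ (hP _ hn).choose_spec
    have ext_eq : ∀ (g : {c : Q // P c} → C) (f : Q → C), (∀ c, g c = f c.1) →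
        (∀ v, f (Quotient.mk _ (outer k v)) = Sum.elim t u v) → ext g = f := by
      intro g f hg hf
      funext c
      by_cases h : P c
      · simp only [ext, dif_pos h]
        exact hg ⟨c, h⟩
      · obtain ⟨v, rfl⟩ := hP c h
        rw [ext_outer, hf]
    have ext_rows : ∀ g, Sum.elim t (Sum.elim (fun j => ext g (Quotient.mk _ (Sum.inr (Sum.inl j))))
        u) = fun x => ext g (Quotient.mk (stack a b) x) := by
      intro g
      funext x
      rcases x with x | x | x
      · exact (ext_outer g (Sum.inl x)).symm
      · rfl
      · exact (ext_outer g (Sum.inr x)).symm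
    let e : {m : Fin k → C // Compat a t m ∧ Compat b m u} ≃ ({c : Q // P c} → C) :=
      { toFun := fun m c => Quotient.lift (Sum.elim t (Sum.elim m.1 u))
          (fun x y hxy => (stack_le_ker a b t m.1 u).2 m.2 hxy) c.1
        invFun := fun g => ⟨fun j => ext g (Quotient.mk _ (Sum.inr (Sum.inl j))), by
          rw [← stack_le_ker, ext_rows]
          intro x y hxy
          exact congrArg (ext g) (Quotient.sound hxy)⟩
        left_inv := by
          rintro ⟨m, hm⟩
          apply Subtype.ext
          have hl := fun x y (hxy : (stack a b) x y) => (stack_le_ker a b t m u).2 hm hxy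
          funext j
          exact congrFun (ext_eq _ (Quotient.lift (Sum.elim t (Sum.elim m u)) hl) (fun c => rfl)
            (fun v => by rcases v with v | v <;> rfl)) (Quotient.mk _ (Sum.inr (Sum.inl j)))
        right_inv := by
          intro g
          funext c
          obtain ⟨c, h⟩ := c
          induction c using Quotient.inductionOn with
          | h x =>
            change Sum.elim t (Sum.elim (fun j => ext g (Quotient.mk _ (Sum.inr (Sum.inl j)))) u) x
              = _
            rw [ext_rows]
            simp only [ext, dif_pos h] }
    rw [Fintype.card_congr e, Fintype.card_fun, ← Nat.card_eq_fintype_card (α := {c : Q // P c})]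
    rfl
  · rw [show wt (comp a b) t u = 0 by simp [wt, hc], mul_zero, Fintype.card_eq_zero_iff]
    refine ⟨fun m => hc ?_⟩
    have h2 := (stack_le_ker a b t m.1 u).2 m.2
    intro x y hxy
    have h3 := h2 hxy
    rw [Setoid.ker_def] at h3 ⊢
    rcases x with x | x <;> rcases y with y | y <;> exact h3

theorem wt_const {k : ℕ} (a : PartitionDiagram k) :
    wt a (fun _ => false) (fun _ => false) = 1 := by
  have : Compat a (fun _ => false) (fun _ => false) := by
    intro x y _
    rw [Setoid.ker_def]
    rcases x with x | x <;> rcases y with y | y <;> rfl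
  simp [wt, this]

/-- A diagram is determined by the two-colourings that are constant on its blocks, and so is
a power of two in front of them. -/
theorem eq_of_wt {k : ℕ} (a b : PartitionDiagram k) (m n : ℕ)
    (h : ∀ t u : Fin k → Bool, 2 ^ m * wt a t u = 2 ^ n * wt b t u) : a = b ∧ m = n := by
  have hmn : m = n := by
    have := h (fun _ => false) (fun _ => false)
    rw [wt_const, wt_const, mul_one, mul_one] at this
    exact Nat.pow_right_injective le_rfl this
  subst hmn
  have hw : ∀ t u : Fin k → Bool, Compat a t u ↔ Compat b t u := by
    intro t u
    have := Nat.eq_of_mul_eq_mul_left (by positivity) (h t u)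
    unfold wt at this
    by_cases h1 : Compat a t u <;> by_cases h2 : Compat b t u <;> simp_all
  have key : ∀ r s : PartitionDiagram k, (∀ t u : Fin k → Bool, Compat s t u → Compat r t u) →
      r ≤ s := by
    classical
    intro r s hrs x y hxy
    have e : ∀ f : Fin k ⊕ Fin k → Bool,
        Sum.elim (fun j => f (Sum.inl j)) (fun j => f (Sum.inr j)) = f := by
      intro f
      funext v
      rcases v with v | v <;> rfl
    have h1 := hrs (fun j => decide (s x (Sum.inl j))) (fun j => decide (s x (Sum.inr j)))
    unfold Compat at h1
    rw [e (fun v => decide (s x v))] at h1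
    have h2 := h1 (fun v w hvw => by
      rw [Setoid.ker_def]
      exact decide_eq_decide.2 ⟨fun h => s.trans' h hvw, fun h => s.trans' h (s.symm' hvw)⟩) hxy
    rw [Setoid.ker_def] at h2
    exact (decide_eq_decide.1 h2).1 (s.refl' x)
  exact ⟨le_antisymm (key _ _ fun t u => (hw t u).2) (key _ _ fun t u => (hw t u).1), rfl⟩

theorem comp_assoc_loops {k : ℕ} (a b c : PartitionDiagram k) :
    comp (comp a b) c = comp a (comp b c) ∧
      loops a b + loops (comp a b) c = loops b c + loops a (comp b c) := by
  classical
  refine eq_of_wt _ _ _ _ fun t u => ?_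
  have h1 := sum_wt_mul_wt (comp a b) c t u
  have h2 := sum_wt_mul_wt a (comp b c) t u
  rw [Fintype.card_bool] at h1 h2
  have l1 := fun m : Fin k → Bool => sum_wt_mul_wt a b t m
  have l2 := fun m : Fin k → Bool => sum_wt_mul_wt b c m u
  simp only [Fintype.card_bool] at l1 l2
  rw [pow_add, pow_add, mul_assoc, mul_assoc, ← h1, ← h2, Finset.mul_sum, Finset.mul_sum]
  calc ∑ m : Fin k → Bool, 2 ^ loops a b * (wt (comp a b) t m * wt c m u)
      = ∑ m : Fin k → Bool, ∑ n : Fin k → Bool, wt a t n * wt b n m * wt c m u := by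
        refine Finset.sum_congr rfl fun m _ => ?_
        rw [← mul_assoc, ← l1, Finset.sum_mul]
    _ = ∑ n : Fin k → Bool, ∑ m : Fin k → Bool, wt a t n * wt b n m * wt c m u :=
        Finset.sum_comm
    _ = ∑ n : Fin k → Bool, 2 ^ loops b c * (wt a t n * wt (comp b c) n u) := by
        refine Finset.sum_congr rfl fun n _ => ?_
        rw [mul_left_comm, ← l2, Finset.mul_sum]
        exact Finset.sum_congr rfl fun m _ => mul_assoc _ _ _

theorem wt_id {k : ℕ} {C : Type*} [DecidableEq C] (t u : Fin k → C) :
    wt (idDiagram k) t u = if t = u then 1 else 0 := by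
  have : Compat (idDiagram k) t u ↔ t = u := by
    unfold Compat idDiagram
    constructor
    · intro h
      funext j
      exact h (show (Setoid.ker (Sum.elim id id)) (Sum.inl j) (Sum.inr j) from rfl)
    · rintro rfl x y hxy
      rw [Setoid.ker_def] at hxy ⊢
      rcases x with x | x <;> rcases y with y | y <;> exact congrArg t hxy
  unfold wt
  simp only [this]

theorem id_comp_loops {k : ℕ} (a : PartitionDiagram k) :
    comp (idDiagram k) a = a ∧ loops (idDiagram k) a = 0 := by
  classical
  refine eq_of_wt _ _ _ _ fun t u => ?_
  have h1 := sum_wt_mul_wt (idDiagram k) a t u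
  rw [Fintype.card_bool] at h1
  rw [← h1]
  simp [wt_id]

theorem comp_id_loops {k : ℕ} (a : PartitionDiagram k) :
    comp a (idDiagram k) = a ∧ loops a (idDiagram k) = 0 := by
  classical
  refine eq_of_wt _ _ _ _ fun t u => ?_
  have h1 := sum_wt_mul_wt a (idDiagram k) t u
  rw [Fintype.card_bool] at h1
  rw [← h1]
  simp [wt_id]

end PartitionDiagram

/-- The partition algebra `𝒜_k(z)`: the free `ℤ[z]`-module on the partition diagrams on `k`
columns, with the product `a b = z ^ ℓ (a ∘ b)` of diagrams, where `ℓ` is the number of blocks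
removed from the middle row. -/
def PartitionAlgebra (k : ℕ) : Type := PartitionDiagram k →₀ ℤ[X]

namespace PartitionAlgebra

noncomputable instance (k : ℕ) : AddCommGroup (PartitionAlgebra k) :=
  inferInstanceAs (AddCommGroup (PartitionDiagram k →₀ ℤ[X]))

noncomputable instance (k : ℕ) : Module ℤ[X] (PartitionAlgebra k) :=
  inferInstanceAs (Module ℤ[X] (PartitionDiagram k →₀ ℤ[X]))

/-- The basis element of a diagram. -/
noncomputable def diag {k : ℕ} (a : PartitionDiagram k) : PartitionAlgebra k :=
  Finsupp.single a (1 : ℤ[X])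

/-- The product of the partition algebra: the `ℤ[z]`-bilinear map with
`(a, b) ↦ z ^ ℓ (a ∘ b)` on diagrams. -/
noncomputable def mulMap (k : ℕ) :
    PartitionAlgebra k →ₗ[ℤ[X]] PartitionAlgebra k →ₗ[ℤ[X]] PartitionAlgebra k :=
  Finsupp.linearCombination ℤ[X] fun a : PartitionDiagram k =>
    (Finsupp.linearCombination ℤ[X] fun b : PartitionDiagram k =>
      (X : ℤ[X]) ^ PartitionDiagram.loops a b • diag (PartitionDiagram.comp a b) :
      (PartitionDiagram k →₀ ℤ[X]) →ₗ[ℤ[X]] PartitionAlgebra k)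

theorem mulMap_diag {k : ℕ} (a b : PartitionDiagram k) :
    mulMap k (diag a) (diag b)
      = (X : ℤ[X]) ^ PartitionDiagram.loops a b • diag (PartitionDiagram.comp a b) := by
  have h1 : mulMap k (diag a) = (Finsupp.linearCombination ℤ[X] fun b : PartitionDiagram k =>
      (X : ℤ[X]) ^ PartitionDiagram.loops a b • diag (PartitionDiagram.comp a b) :
      (PartitionDiagram k →₀ ℤ[X]) →ₗ[ℤ[X]] PartitionAlgebra k) :=
    (Finsupp.linearCombination_single ℤ[X] _ _).trans (one_smul _ _)
  rw [h1]
  exact (Finsupp.linearCombination_single ℤ[X] _ _).trans (one_smul _ _)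

theorem induction_diag {k : ℕ} {p : PartitionAlgebra k → Prop} (x : PartitionAlgebra k)
    (h0 : p 0) (hadd : ∀ x y, p x → p y → p (x + y))
    (hd : ∀ (r : ℤ[X]) (a : PartitionDiagram k), p (r • diag a)) : p x := by
  refine Finsupp.induction_linear (motive := p) x h0 hadd fun a r => ?_
  have h := hd r a
  have e : (r • diag a : PartitionAlgebra k) = (Finsupp.single a r : PartitionDiagram k →₀ ℤ[X]) :=
    (Finsupp.smul_single r a (1 : ℤ[X])).trans (by rw [smul_eq_mul, mul_one])
  rwa [e] at h

theorem mulMap_assoc {k : ℕ} (x y w : PartitionAlgebra k) :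
    mulMap k (mulMap k x y) w = mulMap k x (mulMap k y w) := by
  induction x using induction_diag with
  | h0 => simp
  | hadd x x' h h' => simp [h, h']
  | hd r a =>
    induction y using induction_diag with
    | h0 => simp
    | hadd y y' h h' => simp only [map_add, LinearMap.add_apply, h, h']
    | hd r' b =>
      induction w using induction_diag with
      | h0 => simp
      | hadd w w' h h' => simp only [map_add, h, h']
      | hd r'' c =>
        obtain ⟨h1, h2⟩ := PartitionDiagram.comp_assoc_loops a b c
        simp only [map_smul, LinearMap.smul_apply, mulMap_diag, smul_smul, h1]
        congr 1
        linear_combination (r * r' * r'') * (by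
          rw [← pow_add, ← pow_add, h2] :
          (X : ℤ[X]) ^ PartitionDiagram.loops a b *
              X ^ PartitionDiagram.loops (PartitionDiagram.comp a b) c
            = X ^ PartitionDiagram.loops b c *
              X ^ PartitionDiagram.loops a (PartitionDiagram.comp b c))

noncomputable instance (k : ℕ) : One (PartitionAlgebra k) := ⟨diag (PartitionDiagram.idDiagram k)⟩

noncomputable instance (k : ℕ) : Mul (PartitionAlgebra k) := ⟨fun x y => mulMap k x y⟩

theorem mul_def {k : ℕ} (x y : PartitionAlgebra k) : x * y = mulMap k x y := rfl

theorem one_def {k : ℕ} : (1 : PartitionAlgebra k) = diag (PartitionDiagram.idDiagram k) := rfl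

noncomputable instance (k : ℕ) : Ring (PartitionAlgebra k) :=
  { (inferInstance : AddCommGroup (PartitionAlgebra k)),
    (inferInstance : One (PartitionAlgebra k)), (inferInstance : Mul (PartitionAlgebra k)) with
    left_distrib := fun x y w => map_add (mulMap k x) y w
    right_distrib := fun x y w => by simp only [mul_def, map_add, LinearMap.add_apply]
    zero_mul := fun x => by simp only [mul_def, map_zero, LinearMap.zero_apply]
    mul_zero := fun x => map_zero (mulMap k x)
    mul_assoc := fun x y w => mulMap_assoc x y w
    one_mul := fun x => by
      rw [one_def, mul_def]
      induction x using induction_diag with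
      | h0 => simp
      | hadd x x' h h' => rw [map_add, h, h']
      | hd r a =>
        obtain ⟨h1, h2⟩ := PartitionDiagram.id_comp_loops a
        rw [map_smul, mulMap_diag, h1, h2, pow_zero, one_smul]
    mul_one := fun x => by
      rw [one_def, mul_def]
      induction x using induction_diag with
      | h0 => simp
      | hadd x x' h h' => rw [map_add, LinearMap.add_apply, h, h']
      | hd r a =>
        obtain ⟨h1, h2⟩ := PartitionDiagram.comp_id_loops a
        rw [map_smul, LinearMap.smul_apply, mulMap_diag, h1, h2, pow_zero, one_smul] }

noncomputable instance (k : ℕ) : Algebra ℤ[X] (PartitionAlgebra k) :=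
  Algebra.ofModule (fun r x y => by simp only [mul_def, map_smul, LinearMap.smul_apply])
    (fun r x y => by simp only [mul_def, map_smul])

/-- The scalar `z`, as an element of the algebra. -/
noncomputable def z (k : ℕ) : PartitionAlgebra k := algebraMap ℤ[X] (PartitionAlgebra k) X

/-- The generator `s_i` of `𝒜_k(z)`, for `1 ≤ i ≤ k - 1`. -/
noncomputable def s (k i : ℕ) : PartitionAlgebra k := diag (PartitionDiagram.sDiagram k i)

/-- The generator `p_j` of `𝒜_k(z)`, for `1 ≤ j ≤ k`. -/
noncomputable def p (k j : ℕ) : PartitionAlgebra k := diag (PartitionDiagram.pDiagram k j)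

/-- The generator `p_{i+1/2}` of `𝒜_k(z)`, for `1 ≤ i ≤ k - 1`. -/
noncomputable def pHalf (k i : ℕ) : PartitionAlgebra k := diag (PartitionDiagram.pHalfDiagram k i)

/-- The right-hand side of the recursion for `σ_{i+1}`, `i ≥ 2`, where `S` stands for `σ_i`
and `M` for `L_{i-1}`. -/
noncomputable def sigmaStep (k i : ℕ) (S M : PartitionAlgebra k) : PartitionAlgebra k :=
  s k (i - 1) * s k i * S * s k i * s k (i - 1)
    + s k i * pHalf k (i - 1) * M * s k i * pHalf k (i - 1) * s k i
    + pHalf k (i - 1) * M * s k i * pHalf k (i - 1)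
    - s k i * pHalf k (i - 1) * M * s k (i - 1) * pHalf k i * p k i * pHalf k (i - 1)
    - pHalf k (i - 1) * p k i * pHalf k i * s k (i - 1) * M * pHalf k (i - 1) * s k i

/-- The right-hand side of the recursion for `L_{i+1}`, `i ≥ 1`, where `M` stands for `L_i`
and `S` for `σ_{i+1}`. -/
noncomputable def LStep (k i : ℕ) (M S : PartitionAlgebra k) : PartitionAlgebra k :=
  -(s k i * M * pHalf k i) - pHalf k i * M * s k i + pHalf k i * M * p k (i + 1) * pHalf k i
    + s k i * M * s k i + S

/-- The pair `(L_i, σ_{i+1})`, by simultaneous recursion on `i`. -/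
noncomputable def LSigma (k : ℕ) : ℕ → PartitionAlgebra k × PartitionAlgebra k
  | 0 => (0, 1)
  | 1 => (p k 1, s k 1)
  | (i + 2) => (LStep k (i + 1) (LSigma k (i + 1)).1 (LSigma k (i + 1)).2,
      sigmaStep k (i + 2) (LSigma k (i + 1)).2 (LSigma k (i + 1)).1)

/-- The Jucys--Murphy element `L_i` in `𝒜_k(z)`, for `0 ≤ i ≤ k`. -/
noncomputable def L (k i : ℕ) : PartitionAlgebra k := (LSigma k i).1

/-- The element `σ_i` in `𝒜_k(z)`, for `1 ≤ i ≤ k`. -/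
noncomputable def sigma (k i : ℕ) : PartitionAlgebra k := (LSigma k (i - 1)).2

/-- The element `σ_{i+1/2}` in `𝒜_k(z)`, for `0 ≤ i ≤ k - 1`. In the recursive clause the index
is `i = m + 2`. -/
noncomputable def sigmaHalf (k : ℕ) : ℕ → PartitionAlgebra k
  | 0 => 1
  | 1 => 1
  | (m + 2) =>
    s k (m + 1) * s k (m + 2) * sigmaHalf k (m + 1) * s k (m + 2) * s k (m + 1)
      + pHalf k (m + 1) * L k (m + 1) * s k (m + 2) * pHalf k (m + 1) * s k (m + 2)
      + s k (m + 2) * pHalf k (m + 1) * L k (m + 1) * s k (m + 2) * pHalf k (m + 1)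
      - pHalf k (m + 1) * L k (m + 1) * s k (m + 1) * pHalf k (m + 2) * p k (m + 2)
          * pHalf k (m + 1)
      - s k (m + 2) * pHalf k (m + 1) * p k (m + 2) * pHalf k (m + 2) * s k (m + 1)
          * L k (m + 1) * pHalf k (m + 1) * s k (m + 2)

/-- The Jucys--Murphy element `L_{i+1/2}` in `𝒜_k(z)`, for `0 ≤ i ≤ k - 1`. In the recursive
clause the index is `i = m + 1`. -/
noncomputable def LHalf (k : ℕ) : ℕ → PartitionAlgebra k
  | 0 => 0
  | (m + 1) =>
    -(L k (m + 1) * pHalf k (m + 1)) - pHalf k (m + 1) * L k (m + 1)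
      + pHalf k (m + 1) * L k (m + 1) * p k (m + 1) * pHalf k (m + 1)
      + s k (m + 1) * LHalf k m * s k (m + 1) + sigmaHalf k (m + 1)

/-! The initial values and the defining recursions of `σ_i` and `L_i`. -/

theorem L_zero (k : ℕ) : L k 0 = 0 := rfl

theorem L_one (k : ℕ) : L k 1 = p k 1 := rfl

theorem sigma_one (k : ℕ) : sigma k 1 = 1 := rfl

theorem sigma_two (k : ℕ) : sigma k 2 = s k 1 := rfl

theorem L_succ (k i : ℕ) (hi : 1 ≤ i) : L k (i + 1) =
    -(s k i * L k i * pHalf k i) - pHalf k i * L k i * s k i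
      + pHalf k i * L k i * p k (i + 1) * pHalf k i
      + s k i * L k i * s k i + sigma k (i + 1) := by
  obtain ⟨m, rfl⟩ := Nat.exists_eq_add_of_le' hi
  rfl

theorem sigma_succ (k i : ℕ) (hi : 2 ≤ i) : sigma k (i + 1) =
    s k (i - 1) * s k i * sigma k i * s k i * s k (i - 1)
      + s k i * pHalf k (i - 1) * L k (i - 1) * s k i * pHalf k (i - 1) * s k i
      + pHalf k (i - 1) * L k (i - 1) * s k i * pHalf k (i - 1)
      - s k i * pHalf k (i - 1) * L k (i - 1) * s k (i - 1) * pHalf k i * p k i * pHalf k (i - 1)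
      - pHalf k (i - 1) * p k i * pHalf k i * s k (i - 1) * L k (i - 1) * pHalf k (i - 1)
          * s k i := by
  obtain ⟨m, rfl⟩ := Nat.exists_eq_add_of_le' hi
  rfl

end PartitionAlgebra

/-! Schur–Weyl duality turns the identities into statements about colourings. For a set `C` of `n`
colours, a diagram acts on functions `F` of a colouring `t` by summing `F` over all bottom rows
compatible with `t` as top row; this is an action of the partition algebra with `z` specialized to
`n` (`action_mul`). Once `n ≥ 2k` only elements whose coefficients all vanish at `n` act as zero,
and a polynomial with infinitely many roots is zero, so equality may be tested on all these actions
together (`eq_of_action_eq`).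

The recursively defined elements act by simple formulas. `L_i` sums over all colours `a` the effect
of exchanging `t_i` and `a` in columns `1, …, i`; `σ_{i+1}` exchanges `t_i` and `t_{i+1}` in columns
`1, …, i+1`, and `σ_{i+1/2}` in columns `1, …, i-1`; `z - L_{i+1/2}` sums over `a` the exchange of
`t_{i+1}` and `a` in columns `1, …, i`. Since `p_j` averages (without normalization) over the colour
of column `j` and `p_{j+1/2}` restricts to `t_j = t_{j+1}`, each claim becomes a comparison of
recoloured colourings.

The formulas are proved by induction along the recursions (`action_LStep`, `action_sigmaStep`,
`action_LHalfStep`), splitting by which neighbouring colours agree. The half-integer `σ` needs no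
separate computation, because `σ_{i+1/2} = s_i σ_{i+1}` (`sigmaHalf_eq`). -/

namespace PartitionAlgebra

open PartitionDiagram

/-! ### The action on functions of colourings, and its faithfulness. -/

section Action

variable {k : ℕ} {C : Type*}

/-- The colours of the columns `1, …, k`. -/
def columns (k : ℕ) (t : ℕ → C) : Fin k → C := fun v => t (v.val + 1)

/-- Replace the colours of the columns `1, …, k`. -/
def overwrite (t : ℕ → C) (u : Fin k → C) : ℕ → C := fun j =>
  if h : 1 ≤ j ∧ j ≤ k then u ⟨j - 1, by omega⟩ else t j

theorem columns_overwrite (t : ℕ → C) (u : Fin k → C) : columns k (overwrite t u) = u := by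
  funext v
  have : v.val + 1 ≤ k := v.isLt
  simp [columns, overwrite, this]

theorem overwrite_overwrite (t : ℕ → C) (u u' : Fin k → C) :
    overwrite (overwrite t u) u' = overwrite t u' := by
  funext j
  unfold overwrite
  split_ifs <;> rfl

theorem overwrite_columns (t t' : ℕ → C) (h : ∀ j, ¬(1 ≤ j ∧ j ≤ k) → t' j = t j) :
    overwrite t (columns k t') = t' := by
  funext j
  unfold overwrite columns
  split_ifs with hj
  · simp only
    congr 1
    omega
  · exact (h j hj).symm

/-- A diagram has at most `2k` blocks, so its blocks can be given distinct colours. -/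
theorem exists_columns_ker [Fintype C] (d : PartitionDiagram k) (hC : 2 * k ≤ Fintype.card C) :
    ∃ t u : Fin k → C, Setoid.ker (Sum.elim t u) = d := by
  have h1 : Nat.card (Quotient d) ≤ Fintype.card C := by
    refine (Nat.card_le_card_of_surjective _ (Quotient.mk_surjective (s := d))).trans ?_
    rw [Nat.card_eq_fintype_card, Fintype.card_sum, Fintype.card_fin]
    omega
  classical
  rw [Nat.card_eq_fintype_card] at h1
  obtain ⟨g⟩ := Function.Embedding.nonempty_of_card_le h1
  refine ⟨fun v => g (Quotient.mk d (Sum.inl v)), fun v => g (Quotient.mk d (Sum.inr v)), ?_⟩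
  ext x y
  have e : Sum.elim (fun v => g (Quotient.mk d (Sum.inl v)))
      (fun v => g (Quotient.mk d (Sum.inr v))) = fun v => g (Quotient.mk d v) := by
    funext v
    rcases v with v | v <;> rfl
  rw [e, Setoid.ker_def, g.apply_eq_iff_eq]
  exact Quotient.eq

variable [Fintype C] [DecidableEq C]

/-- The action of a diagram on integer-valued functions of the colourings of the columns. -/
noncomputable def diagAction (C : Type*) [Fintype C] [DecidableEq C] {k : ℕ}
    (a : PartitionDiagram k) : Module.End ℤ ((ℕ → C) → ℤ) where
  toFun F t := ∑ u : Fin k → C, (wt a (columns k t) u : ℤ) * F (overwrite t u)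
  map_add' F G := by
    funext t
    simp [mul_add, Finset.sum_add_distrib]
  map_smul' r F := by
    funext t
    simp [Finset.mul_sum, mul_left_comm]

theorem diagAction_apply (a : PartitionDiagram k) (F : (ℕ → C) → ℤ) (t : ℕ → C) :
    diagAction C a F t = ∑ u : Fin k → C, (wt a (columns k t) u : ℤ) * F (overwrite t u) := rfl

theorem diagAction_mul (a b : PartitionDiagram k) :
    diagAction C a * diagAction C b
      = ((Fintype.card C : ℤ) ^ loops a b) • diagAction C (comp a b) := by
  refine LinearMap.ext fun F => funext fun t => ?_
  simp only [Module.End.mul_apply, LinearMap.smul_apply, Pi.smul_apply, diagAction_apply,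
    columns_overwrite, overwrite_overwrite, Finset.mul_sum, smul_eq_mul]
  rw [Finset.sum_comm]
  refine Finset.sum_congr rfl fun u _ => ?_
  have h := congrArg (Nat.cast : ℕ → ℤ) (sum_wt_mul_wt a b (columns k t) u)
  push_cast at h
  rw [← mul_assoc, ← h, Finset.sum_mul]
  refine Finset.sum_congr rfl fun m _ => ?_
  convert (mul_assoc _ _ _).symm

/-- The coefficients of an element in the basis of diagrams. -/
def coeff (x : PartitionAlgebra k) : PartitionDiagram k →₀ ℤ[X] := x

theorem coeff_smul_diag (r : ℤ[X]) (a : PartitionDiagram k) :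
    coeff (r • diag a) = Finsupp.single a r :=
  (Finsupp.smul_single r a (1 : ℤ[X])).trans (by rw [smul_eq_mul, mul_one])

/-- The action of the partition algebra on functions of the colourings of the columns, the
indeterminate being specialized to the number of colours. -/
noncomputable def action (C : Type*) [Fintype C] [DecidableEq C] (k : ℕ) :
    PartitionAlgebra k →+ Module.End ℤ ((ℕ → C) → ℤ) where
  toFun x := (coeff x).sum fun a r => r.eval (Fintype.card C : ℤ) • diagAction C a
  map_zero' := Finsupp.sum_zero_index
  map_add' x y := Finsupp.sum_add_index' (fun a => by rw [eval_zero, zero_smul])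
    fun a r r' => by rw [eval_add, add_smul]

theorem action_eq_sum (x : PartitionAlgebra k) :
    action C k x = (coeff x).sum fun a r => r.eval (Fintype.card C : ℤ) • diagAction C a :=
  rfl

theorem action_smul_diag (r : ℤ[X]) (a : PartitionDiagram k) :
    action C k (r • diag a) = r.eval (Fintype.card C : ℤ) • diagAction C a := by
  rw [action_eq_sum, coeff_smul_diag]
  exact Finsupp.sum_single_index (by rw [eval_zero, zero_smul])

theorem action_diag (a : PartitionDiagram k) : action C k (diag a) = diagAction C a := by
  rw [← one_smul ℤ[X] (diag a), action_smul_diag, eval_one, one_smul]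

theorem action_mul (x y : PartitionAlgebra k) :
    action C k (x * y) = action C k x * action C k y := by
  induction x using induction_diag with
  | h0 => simp
  | hadd x x' h h' => rw [add_mul, map_add, map_add, add_mul, h, h']
  | hd r a =>
    induction y using induction_diag with
    | h0 => simp
    | hadd y y' h h' => rw [mul_add, map_add, map_add, mul_add, h, h']
    | hd q b =>
      rw [mul_def, LinearMap.map_smul₂, LinearMap.map_smul, mulMap_diag, smul_smul, smul_smul,
        action_smul_diag, action_smul_diag, action_smul_diag, smul_mul_smul_comm, diagAction_mul,
        smul_smul]
      congr 1
      simp only [eval_mul, eval_pow, eval_X]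

/-- Applying the operator to an indicator function reads off its matrix entry at `(t, u)`. -/
theorem action_indicator [Nonempty C] (x : PartitionAlgebra k) (t u : Fin k → C) :
    action C k x (fun t' => if columns k t' = u then 1 else 0)
        (overwrite (fun _ => Classical.arbitrary C) t)
      = (coeff x).sum fun a r => r.eval (Fintype.card C : ℤ) * (wt a t u : ℤ) := by
  rw [action_eq_sum, Finsupp.sum, Finsupp.sum, LinearMap.sum_apply, Finset.sum_apply]
  refine Finset.sum_congr rfl fun a _ => ?_
  simp [diagAction_apply, columns_overwrite]

theorem eval_eq_zero_of_action (x : PartitionAlgebra k) [Nonempty C]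
    (hC : 2 * k ≤ Fintype.card C) (hx : action C k x = 0) (d : PartitionDiagram k) :
    (coeff x d).eval (Fintype.card C : ℤ) = 0 := by
  classical
  have : Finite (PartitionDiagram k) :=
    Finite.of_injective (fun d v w => d v w) fun d d' h => Setoid.ext fun v w => by
      exact iff_of_eq (congrFun (congrFun h v) w)
  -- The system is triangular for refinement: at a colouring with kernel exactly `d`, only diagrams
  -- `a ≤ d` contribute, and the strictly finer ones vanish by induction.
  induction d using WellFoundedLT.induction with
  | ind d ih =>
    obtain ⟨t, u, hd⟩ := exists_columns_ker d hC
    have h := action_indicator x t u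
    rw [hx] at h
    rw [Finsupp.sum, Finset.sum_eq_single d] at h
    · have : wt d t u = 1 := by simp [wt, Compat, hd]
      rw [this] at h
      simpa using h.symm
    · intro a _ had
      by_cases hle : a ≤ d
      · have h0 := ih a (lt_of_le_of_ne hle had)
        exact mul_eq_zero_of_left h0 _
      · have : wt a t u = 0 := by simp [wt, Compat, hd, hle]
        simp [this]
    · intro hd0
      have := Finsupp.notMem_support_iff.1 hd0
      exact mul_eq_zero_of_left (by rw [this, eval_zero]) _

end Action

/-- The actions on colourings with finitely many colours are jointly faithful. -/
theorem eq_of_action_eq {k : ℕ} {x y : PartitionAlgebra k}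
    (h : ∀ n : ℕ, action (Fin (n + 1)) k x = action (Fin (n + 1)) k y) : x = y := by
  rw [← sub_eq_zero]
  refine Finsupp.ext fun d => ?_
  -- Every number of colours `2k + n + 1` is a root of each coefficient of the difference.
  refine Polynomial.eq_zero_of_infinite_isRoot _ (Set.Infinite.mono (s := Set.range
    fun n : ℕ => ((2 * k + n + 1 : ℕ) : ℤ)) ?_ (Set.infinite_range_of_injective fun m n hmn => ?_))
  · rintro _ ⟨n, rfl⟩
    have := eval_eq_zero_of_action (C := Fin (2 * k + n + 1)) (x - y) (by simp; omega)
      (by rw [map_sub, h, sub_self]) d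
    rwa [Fintype.card_fin] at this
  · simpa using hmn

/-! ### The action of the generators. -/

section Generators

variable {k : ℕ} {C : Type*} [Fintype C] [DecidableEq C]

/-- The sum over bottom rows has a single nonzero term, so the diagram acts by substitution. -/
theorem diagAction_of_unique (a : PartitionDiagram k) (F : (ℕ → C) → ℤ) (t t' : ℕ → C)
    (hout : ∀ j, ¬(1 ≤ j ∧ j ≤ k) → t' j = t j)
    (ha : ∀ u, Compat a (columns k t) u ↔ u = columns k t') :
    diagAction C a F t = F t' := by
  rw [diagAction_apply, Finset.sum_eq_single (columns k t')]
  · rw [overwrite_columns t t' hout]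
    simp [wt, (ha _).2 rfl]
  · intro u _ hu
    simp [wt, ha, hu]
  · simp

theorem action_s {i : ℕ} (hi : 1 ≤ i) (hk : i + 1 ≤ k) (F : (ℕ → C) → ℤ) (t : ℕ → C) :
    action C k (s k i) F t = F (fun j => t (Equiv.swap i (i + 1) j)) := by
  rw [s, action_diag]
  refine diagAction_of_unique _ _ _ _ (fun j hj => ?_) fun u => ⟨fun h => funext fun v => ?_, ?_⟩
  · rw [Equiv.swap_apply_of_ne_of_ne] <;> omega
  · have hv := v.isLt
    obtain ⟨w, hw⟩ : ∃ w : Fin k, w.val + 1 = Equiv.swap i (i + 1) (v.val + 1) := by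
      refine ⟨⟨Equiv.swap i (i + 1) (v.val + 1) - 1, ?_⟩, ?_⟩ <;>
        · simp only [Equiv.swap_apply_def]
          split_ifs <;> omega
    have := h (show (sDiagram k i) (Sum.inl w) (Sum.inr v) from hw)
    rw [Setoid.ker_def] at this
    simp only [Sum.elim_inl, Sum.elim_inr, columns, hw] at this
    exact this.symm
  · rintro rfl x y hxy
    have key : ∀ x : Fin k ⊕ Fin k, Sum.elim (columns k t)
        (columns k fun j => t (Equiv.swap i (i + 1) j)) x = t (Sum.elim (fun v : Fin k => v.val + 1)
          (fun v : Fin k => Equiv.swap i (i + 1) (v.val + 1)) x) := by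
      rintro (x | x) <;> rfl
    rw [Setoid.ker_def, key, key]
    exact congrArg t hxy

theorem action_pHalf {i : ℕ} (hi : 1 ≤ i) (hk : i + 1 ≤ k) (F : (ℕ → C) → ℤ) (t : ℕ → C) :
    action C k (pHalf k i) F t = if t i = t (i + 1) then F t else 0 := by
  have hl : ∀ v : Fin k, (pHalfDiagram k i) (Sum.inl v) (Sum.inr v) := fun v => rfl
  rw [pHalf, action_diag]
  split_ifs with ht
  · refine diagAction_of_unique _ _ _ _ (fun _ _ => rfl)
      fun u => ⟨fun h => funext fun v => ?_, ?_⟩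
    · exact (h (hl v)).symm
    · rintro rfl x y hxy
      have key : ∀ x : Fin k ⊕ Fin k, Sum.elim (columns k t) (columns k t) x
          = t (Sum.elim (fun v : Fin k => if v.val + 1 = i + 1 then i else v.val + 1)
            (fun v : Fin k => if v.val + 1 = i + 1 then i else v.val + 1) x) := by
        rintro (x | x) <;> simp only [Sum.elim_inl, Sum.elim_inr, columns] <;> split_ifs with h <;>
          simp [h, ht]
      rw [Setoid.ker_def, key, key]
      exact congrArg t hxy
  · rw [diagAction_apply]
    refine Finset.sum_eq_zero fun u _ => ?_
    have : ¬ Compat (pHalfDiagram k i) (columns k t) u := by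
      intro h
      have := h (show (pHalfDiagram k i) (Sum.inl ⟨i - 1, by omega⟩) (Sum.inl ⟨i, by omega⟩) by
        show (if i - 1 + 1 = i + 1 then i else i - 1 + 1) = (if i + 1 = i + 1 then i else i + 1)
        rw [if_pos rfl]
        split_ifs <;> omega)
      rw [Setoid.ker_def] at this
      simp only [Sum.elim_inl, columns] at this
      rw [Nat.sub_add_cancel hi] at this
      exact ht this
    simp [wt, this]

theorem action_p {j : ℕ} (hj : 1 ≤ j) (hk : j ≤ k) (F : (ℕ → C) → ℤ) (t : ℕ → C) :
    action C k (p k j) F t = ∑ c, F (Function.update t j c) := by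
  classical
  have hc : ∀ u : Fin k → C, Compat (pDiagram k j) (columns k t) u ↔
      ∀ v : Fin k, v.val + 1 ≠ j → u v = t (v.val + 1) := by
    intro u
    constructor
    · intro h v hv
      have := h (show (pDiagram k j) (Sum.inl v) (Sum.inr v) by
        show (Sum.inl v : Fin k ⊕ Fin k) = if v.val + 1 = j then Sum.inr v else Sum.inl v
        rw [if_neg hv])
      exact this.symm
    · intro h x y hxy
      have key : ∀ x : Fin k ⊕ Fin k, Sum.elim (columns k t) u x = Sum.elim (columns k t) u
          (Sum.elim (fun v : Fin k => (Sum.inl v : Fin k ⊕ Fin k))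
            (fun v : Fin k => if v.val + 1 = j then Sum.inr v else Sum.inl v) x) := by
        rintro (x | x)
        · rfl
        · simp only [Sum.elim_inr]
          split_ifs with hx
          · rfl
          · exact h x hx
      rw [Setoid.ker_def, key x, key y]
      exact congrArg _ hxy
  let v0 : Fin k := ⟨j - 1, by omega⟩
  have hup : ∀ c, overwrite t (columns k (Function.update t j c)) = Function.update t j c := by
    refine fun c => overwrite_columns _ _ fun i hi => Function.update_of_ne ?_ _ _
    omega
  rw [p, action_diag, diagAction_apply]
  symm
  rw [← Finset.sum_subset (Finset.subset_univ
    (Finset.univ.image fun c => columns k (Function.update t j c)))]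
  · rw [Finset.sum_image]
    · refine Finset.sum_congr rfl fun c _ => ?_
      have : Compat (pDiagram k j) (columns k t) (columns k (Function.update t j c)) :=
        (hc _).2 fun v hv => Function.update_of_ne hv _ _
      rw [hup]
      simp [wt, this]
    · intro c _ c' _ h
      have := congrFun h v0
      simpa [columns, v0, Nat.sub_add_cancel hj] using this
  · intro u _ hu
    have : ¬ Compat (pDiagram k j) (columns k t) u := by
      intro h
      refine hu (Finset.mem_image.2 ⟨u v0, Finset.mem_univ _, ?_⟩)
      funext v
      by_cases hv : v.val + 1 = j
      · have : v = v0 := Fin.ext (by simp only [v0]; omega)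
        rw [← this]
        simp only [columns, hv, Function.update_self]
      · simp only [columns, Function.update_of_ne hv]
        exact ((hc u).1 h v hv).symm
    simp [wt, this]

theorem action_one (F : (ℕ → C) → ℤ) (t : ℕ → C) : action C k 1 F t = F t := by
  rw [one_def, action_diag]
  refine diagAction_of_unique _ _ _ _ (fun _ _ => rfl) fun u => ?_
  constructor
  · intro h
    exact funext fun v => (h (show (idDiagram k) (Sum.inl v) (Sum.inr v) from rfl)).symm
  · rintro rfl x y hxy
    rw [Setoid.ker_def]
    change Sum.elim id id x = Sum.elim id id y at hxy
    rcases x with x | x <;> rcases y with y | y <;> exact congrArg (columns k t) hxy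

theorem action_z (F : (ℕ → C) → ℤ) (t : ℕ → C) :
    action C k (z k) F t = Fintype.card C * F t := by
  have : z k = (X : ℤ[X]) • diag (idDiagram k) := by
    rw [z, Algebra.algebraMap_eq_smul_one, one_def]
  rw [this, action_smul_diag, eval_X, ← action_diag, ← one_def, LinearMap.smul_apply,
    Pi.smul_apply, action_one, smul_eq_mul]

end Generators

/-- Exchange the colours `a` and `b` in the columns `1, …, m`. -/
def swapOn {C : Type*} [DecidableEq C] (m : ℕ) (a b : C) (t : ℕ → C) : ℕ → C := fun j =>
  if 1 ≤ j ∧ j ≤ m then Equiv.swap a b (t j) else t j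

theorem swapOn_apply {C : Type*} [DecidableEq C] (m : ℕ) (a b : C) (t : ℕ → C) (j : ℕ) :
    swapOn m a b t j =
      if 1 ≤ j ∧ j ≤ m then if t j = a then b else if t j = b then a else t j else t j := by
  rw [swapOn, Equiv.swap_apply_def]

theorem sum_sub_sum_eq_of_ne {C : Type*} [Fintype C] {f g : C → ℤ} (c : C) (h : ∀ a, a ≠ c → f a = g a) :
    ∑ a, f a - ∑ a, g a = f c - g c := by
  rw [← Finset.sum_sub_distrib]
  exact Finset.sum_eq_single c (fun a _ ha => by rw [h a ha, sub_self]) (by simp)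

/-! ### The recursions preserve the colour-exchange formulas. -/

section JucysMurphy

variable {k : ℕ} {C : Type*} [Fintype C] [DecidableEq C]

theorem action_LStep {i : ℕ} (hi : 1 ≤ i) (hk : i + 1 ≤ k) (S M : PartitionAlgebra k)
    (hM : ∀ (F : (ℕ → C) → ℤ) t, action C k M F t = ∑ a, F (swapOn i (t i) a t))
    (hS : ∀ (F : (ℕ → C) → ℤ) t,
      action C k S F t = F (swapOn (i + 1) (t i) (t (i + 1)) t))
    (F : (ℕ → C) → ℤ) (t : ℕ → C) :
    action C k (LStep k i M S) F t = ∑ a, F (swapOn (i + 1) (t (i + 1)) a t) := by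
  have h0 : 1 ≤ i + 1 := by omega
  simp only [LStep, map_add, map_sub, map_neg, action_mul, Module.End.mul_apply,
    LinearMap.add_apply, LinearMap.sub_apply, LinearMap.neg_apply, Pi.add_apply, Pi.sub_apply,
    Pi.neg_apply, action_s hi hk, action_pHalf hi hk, action_p h0 hk, hM, hS]
  simp [swapOn_apply, hi]
  -- If the two colours agree, the five terms cancel or match in pairs. Otherwise the terms starting
  -- with `pHalf k i` vanish, and the sum from `s_i L_i s_i` differs from the target only at `a = t
  -- i`; the other two terms correct this summand.
  by_cases hxy : t i = t (i + 1)
  · have key : ∀ a b c d e f : ℤ, a = e → b = d → c = f → -a - b + c + d + e = f := by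
      intro a b c d e f h h' h''
      rw [h, h', h'']
      ring
    simp only [hxy, if_true]
    refine key _ _ _ _ _ _ (congrArg F (funext fun j => ?_))
      (Finset.sum_congr rfl fun a _ => congrArg F (funext fun j => ?_))
      (Finset.sum_congr rfl fun a _ => congrArg F (funext fun j => ?_)) <;>
    simp only [swapOn_apply, Equiv.swap_apply_def, Function.update_apply] <;> grind
  · have key : ∀ a d e f : ℤ, d - f = a - e → -a - 0 + 0 + d + e = f := by
      intro a d e f h
      linear_combination h
    simp only [hxy, if_false]
    refine key _ _ _ _ ((sum_sub_sum_eq_of_ne (t i) fun a ha =>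
      congrArg F (funext fun j => ?_)).trans (congrArg₂ (fun u v => F u - F v)
        (funext fun j => ?_) (funext fun j => ?_))) <;>
    simp only [swapOn_apply, Equiv.swap_apply_def] <;> grind

theorem action_LHalfStep {i : ℕ} (hi : 1 ≤ i) (hk : i + 1 ≤ k) (S M N : PartitionAlgebra k)
    (hM : ∀ (F : (ℕ → C) → ℤ) t, action C k M F t = ∑ a, F (swapOn i (t i) a t))
    (hN : ∀ (F : (ℕ → C) → ℤ) t, action C k N F t
      = Fintype.card C * F t - ∑ a, F (swapOn (i - 1) (t i) a t))
    (hS : ∀ (F : (ℕ → C) → ℤ) t,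
      action C k S F t = F (swapOn (i - 1) (t i) (t (i + 1)) t))
    (F : (ℕ → C) → ℤ) (t : ℕ → C) :
    action C k (-(M * pHalf k i) - pHalf k i * M + pHalf k i * M * p k i * pHalf k i
        + s k i * N * s k i + S) F t
      = Fintype.card C * F t - ∑ a, F (swapOn i (t (i + 1)) a t) := by
  have h0 : i ≤ k := by omega
  simp only [map_add, map_sub, map_neg, action_mul, Module.End.mul_apply,
    LinearMap.add_apply, LinearMap.sub_apply, LinearMap.neg_apply, Pi.add_apply, Pi.sub_apply,
    Pi.neg_apply, action_s hi hk, action_pHalf hi hk, action_p hi h0, hM, hS, hN]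
  simp [swapOn_apply, hi]
  -- When the colours differ, the sum inside `s_i N s_i` and the target sum again disagree only at
  -- `a = t i`, where column `i` is exchanged in the target but not in the former.
  by_cases hxy : t i = t (i + 1)
  · have key : ∀ a b c d e f g : ℤ, a = e → b = f → c = d → -a - b + c + (g - d) + e = g - f := by
      intro a b c d e f g h h' h''
      rw [h, h', h'']
      ring
    simp only [hxy, if_true]
    refine key _ _ _ _ _ _ _ (congrArg F (funext fun j => ?_))
      (Finset.sum_congr rfl fun a _ => congrArg F (funext fun j => ?_))
      (Finset.sum_congr rfl fun a _ => congrArg F (funext fun j => ?_)) <;>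
    simp only [swapOn_apply, Equiv.swap_apply_def, Function.update_apply] <;> grind
  · have key : ∀ a d e f g : ℤ, d - f = e - a → -a - 0 + 0 + (g - d) + e = g - f := by
      intro a d e f g h
      linear_combination -h
    simp only [hxy, if_false]
    refine key _ _ _ _ _ ((sum_sub_sum_eq_of_ne (t i) fun a ha =>
      congrArg F (funext fun j => ?_)).trans (congrArg₂ (fun u v => F u - F v)
        (funext fun j => ?_) (funext fun j => ?_))) <;>
    simp only [swapOn_apply, Equiv.swap_apply_def] <;> grind

theorem action_sigmaStep {m : ℕ} (hm : 1 ≤ m) (hk : m + 2 ≤ k) (S M : PartitionAlgebra k)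
    (hM : ∀ (F : (ℕ → C) → ℤ) t, action C k M F t = ∑ a, F (swapOn m (t m) a t))
    (hS : ∀ (F : (ℕ → C) → ℤ) t,
      action C k S F t = F (swapOn (m + 1) (t m) (t (m + 1)) t))
    (F : (ℕ → C) → ℤ) (t : ℕ → C) :
    action C k (sigmaStep k (m + 1) S M) F t
      = F (swapOn (m + 2) (t (m + 1)) (t (m + 2)) t) := by
  have h0 : 1 ≤ m + 1 := by omega
  have h1 : m + 1 ≤ k := by omega
  have s1 : Equiv.swap (m + 1) (m + 2) m = m :=
    Equiv.swap_apply_of_ne_of_ne (by omega) (by omega)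
  have s2 : Equiv.swap m (m + 1) (m + 2) = m + 2 :=
    Equiv.swap_apply_of_ne_of_ne (by omega) (by omega)
  simp only [sigmaStep, Nat.add_sub_cancel, map_add, map_sub, action_mul, Module.End.mul_apply,
    LinearMap.add_apply, LinearMap.sub_apply, Pi.add_apply, Pi.sub_apply, action_s hm h1,
    action_s h0 hk, action_pHalf hm h1, action_pHalf h0 hk, action_p h0 h1, hM, hS]
  simp [swapOn_apply, hm, Function.update_apply, s1, s2]
  -- The second and fourth terms survive only if `t m = t (m + 2)`, the third and fifth only if `t m
  -- = t (m + 1)`. In each case one surviving positive term is the target and the rest cancel in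
  -- pairs.
  by_cases hxw : t m = t (m + 1 + 1)
  · have key : ∀ a b c d e f : ℤ, a = d → b = f → c = e → a + b + c - d - e = f := by
      intro a b c d e f h h' h''
      rw [h, h', h'']
      ring
    rw [if_pos hxw, if_pos hxw]
    refine key _ _ _ _ _ _ (congrArg F (funext fun j => ?_)) (congrArg F (funext fun j => ?_)) ?_
    · simp only [Equiv.swap_apply_def, Function.update_apply]
      grind
    · simp only [swapOn_apply, Equiv.swap_apply_def]
      grind
    · split_ifs with hxy
      · refine congrArg F (funext fun j => ?_)
        simp only [Equiv.swap_apply_def]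
        grind
      · rfl
  · have key : ∀ a c e f : ℤ, a + c - e = f → a + 0 + c - 0 - e = f := by
      intro a c e f h
      rw [← h]
      ring
    rw [if_neg hxw, if_neg hxw]
    refine key _ _ _ _ ?_
    by_cases hxy : t m = t (m + 1)
    · have key : ∀ a c e f : ℤ, a = e → c = f → a + c - e = f := by
        intro a c e f h h'
        rw [h, h']
        ring
      rw [if_pos hxy, if_pos hxy]
      refine key _ _ _ _ (congrArg F (funext fun j => ?_)) (congrArg F (funext fun j => ?_))
      · simp only [Equiv.swap_apply_def]
        grind
      · simp only [swapOn_apply, Equiv.swap_apply_def]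
        grind
    · rw [if_neg hxy, if_neg hxy, add_zero, sub_zero]
      refine congrArg F (funext fun j => ?_)
      simp only [swapOn_apply, Equiv.swap_apply_def]
      grind

end JucysMurphy

/-! ### Closed formulas for the action of the Jucys–Murphy elements. -/

section JucysMurphyAction

variable {k : ℕ}

theorem s_mul_s {i : ℕ} (hi : 1 ≤ i) (hk : i + 1 ≤ k) : s k i * s k i = 1 := by
  refine eq_of_action_eq fun n => LinearMap.ext fun F => funext fun t => ?_
  simp [action_mul, action_s hi hk, action_one]

theorem s_braid {i : ℕ} (hi : 1 ≤ i) (hk : i + 2 ≤ k) :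
    s k (i + 1) * s k i * s k (i + 1) = s k i * s k (i + 1) * s k i := by
  have h0 : 1 ≤ i + 1 := by omega
  have h1 : i + 1 ≤ k := by omega
  refine eq_of_action_eq fun n => LinearMap.ext fun F => funext fun t => ?_
  simp only [action_mul, Module.End.mul_apply, action_s hi h1, action_s h0 hk]
  refine congrArg F (funext fun j => congrArg t ?_)
  simp only [Equiv.swap_apply_def]
  grind

/-- Left multiplication by `s_i` carries one recursion to the other term by term: `s_i² = 1` handles
the terms with `L_{i-1}`, and the braid relation the conjugated one. -/
theorem sigmaHalf_eq {i : ℕ} (hi : 1 ≤ i) (hk : i + 1 ≤ k) :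
    sigmaHalf k i = s k i * sigma k (i + 1) := by
  induction i, hi using Nat.le_induction with
  | base => rw [sigma_two, s_mul_s le_rfl hk, sigmaHalf]
  | succ m hm ih =>
    obtain ⟨m, rfl⟩ := Nat.exists_eq_add_of_le' hm
    have h2 := s_mul_s (k := k) (i := m + 2) (by omega) hk
    have hb := s_braid (k := k) hm hk
    change sigmaHalf k (m + 2) = s k (m + 2) * sigma k (m + 2 + 1)
    rw [sigma_succ k (m + 2) (by omega), sigmaHalf, ih (by omega)]
    simp only [Nat.add_one_sub_one, mul_add, mul_sub, ← mul_assoc, h2, one_mul]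
    rw [hb]

variable {C : Type*} [Fintype C] [DecidableEq C]

/-- The two formulas are proved together because each recursion uses both elements; the bounds are
separate because `L_k` is covered but `σ_{k+1}` is not. -/
theorem action_L_sigma {i : ℕ} (hi : 1 ≤ i) :
    (i ≤ k → ∀ (F : (ℕ → C) → ℤ) t, action C k (L k i) F t = ∑ a, F (swapOn i (t i) a t)) ∧
    (i + 1 ≤ k → ∀ (F : (ℕ → C) → ℤ) t,
      action C k (sigma k (i + 1)) F t = F (swapOn (i + 1) (t i) (t (i + 1)) t)) := by
  induction i, hi using Nat.le_induction with
  | base =>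
    refine ⟨fun hk F t => ?_, fun hk F t => ?_⟩
    · rw [L_one, action_p le_rfl hk]
      refine Finset.sum_congr rfl fun a _ => congrArg F (funext fun j => ?_)
      simp only [swapOn_apply, Function.update_apply]
      grind
    · rw [sigma_two, action_s le_rfl hk]
      refine congrArg F (funext fun j => ?_)
      simp only [swapOn_apply, Equiv.swap_apply_def]
      grind
  | succ m hm ih =>
    obtain ⟨n, rfl⟩ := Nat.exists_eq_add_of_le' hm
    exact ⟨fun hk => action_LStep hm hk _ _ (ih.1 (by omega)) (ih.2 hk),
      fun hk => action_sigmaStep hm hk _ _ (ih.1 (by omega)) (ih.2 (by omega))⟩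

theorem action_L {i : ℕ} (hi : 1 ≤ i) (hk : i ≤ k) (F : (ℕ → C) → ℤ) (t : ℕ → C) :
    action C k (L k i) F t = ∑ a, F (swapOn i (t i) a t) :=
  (action_L_sigma hi).1 hk F t

theorem action_sigma {i : ℕ} (hi : 1 ≤ i) (hk : i + 1 ≤ k) (F : (ℕ → C) → ℤ) (t : ℕ → C) :
    action C k (sigma k (i + 1)) F t = F (swapOn (i + 1) (t i) (t (i + 1)) t) :=
  (action_L_sigma hi).2 hk F t

theorem action_sigmaHalf {i : ℕ} (hi : 1 ≤ i) (hk : i + 1 ≤ k) (F : (ℕ → C) → ℤ) (t : ℕ → C) :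
    action C k (sigmaHalf k i) F t = F (swapOn (i - 1) (t i) (t (i + 1)) t) := by
  rw [sigmaHalf_eq hi hk, action_mul, Module.End.mul_apply, action_s hi hk, action_sigma hi hk]
  -- On columns `i` and `i + 1` the exchange of colours undoes the exchange of columns, so only
  -- columns `1, …, i-1` change.
  refine congrArg F (funext fun j => ?_)
  simp only [swapOn_apply, Equiv.swap_apply_def]
  grind

theorem action_LHalf {i : ℕ} (hk : i + 1 ≤ k) (F : (ℕ → C) → ℤ) (t : ℕ → C) :
    action C k (LHalf k i) F t
      = Fintype.card C * F t - ∑ a, F (swapOn i (t (i + 1)) a t) := by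
  induction i generalizing F t with
  | zero =>
    have : ∀ a, swapOn 0 (t (0 + 1)) a t = t := fun a => funext fun j => by
      rw [swapOn, if_neg (by omega)]
    simp [LHalf, this]
  | succ m ih =>
    exact action_LHalfStep (by omega) hk _ _ _ (action_L (by omega) (by omega))
      (fun F t => ih (by omega) F t) (action_sigmaHalf (by omega) hk) F t

end JucysMurphyAction

/-! ### The four identities. -/

/-- The left `p_{i+1}` makes the colour `a` of column `i+1` free, so `σ_{i+1}` exchanges `t_i` with
an arbitrary `a`, as `L_i` does; the right `p_{i+1}` hides the effect on column `i+1`. -/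
theorem p_mul_sigma_mul_p {k i : ℕ} (hi : 1 ≤ i) (hk : i + 1 ≤ k) :
    p k (i + 1) * sigma k (i + 1) * p k (i + 1) = L k i * p k (i + 1) := by
  refine eq_of_action_eq fun n => LinearMap.ext fun F => funext fun t => ?_
  simp only [action_mul, Module.End.mul_apply, action_p (Nat.le_add_left 1 i) hk,
    action_sigma hi hk, action_L hi (Nat.le_of_succ_le hk)]
  refine Finset.sum_congr rfl fun a _ => Finset.sum_congr rfl fun b _ =>
    congrArg F (funext fun j => ?_)
  simp only [swapOn_apply, Function.update_apply]
  grind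

theorem p_mul_sigmaHalf_mul_p {k i : ℕ} (hi : 1 ≤ i) (hk : i + 1 ≤ k) :
    p k (i + 1) * sigmaHalf k i * p k (i + 1) = (z k - LHalf k (i - 1)) * p k (i + 1) := by
  obtain ⟨m, rfl⟩ := Nat.exists_eq_add_of_le' hi
  refine eq_of_action_eq fun n => LinearMap.ext fun F => funext fun t => ?_
  simp only [action_mul, map_sub, Module.End.mul_apply, LinearMap.sub_apply, Pi.sub_apply,
    Nat.add_sub_cancel, action_p (Nat.le_add_left 1 _) hk, action_sigmaHalf hi hk, action_z,
    action_LHalf (Nat.le_of_succ_le hk), sub_sub_cancel]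
  refine Finset.sum_congr rfl fun a _ => Finset.sum_congr rfl fun b _ =>
    congrArg F (funext fun j => ?_)
  simp only [swapOn_apply, Function.update_apply]
  grind

theorem pHalf_mul_sigma_mul_pHalf {k i : ℕ} (hi : 1 ≤ i) (hk : i + 2 ≤ k) :
    pHalf k (i + 1) * sigma k (i + 1) * pHalf k (i + 1) = pHalf k i * pHalf k (i + 1) := by
  refine eq_of_action_eq fun n => LinearMap.ext fun F => funext fun t => ?_
  simp only [action_mul, Module.End.mul_apply, action_pHalf (Nat.le_add_left 1 i) hk,
    action_pHalf hi (Nat.le_of_succ_le hk), action_sigma hi (Nat.le_of_succ_le hk)]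
  have h : t i = t (i + 1) → swapOn (i + 1) (t i) (t (i + 1)) t = t := fun h => funext fun j => by
    rw [swapOn, h, Equiv.swap_self, Equiv.refl_apply, ite_self]
  -- After the exchange column `i+1` has colour `t i` and column `i+2` is untouched, so the two
  -- restrictions force all three colours to agree, and then the exchange is trivial.
  have h1 : swapOn (i + 1) (t i) (t (i + 1)) t (i + 1) = t i := by
    simp [swapOn]
  have h2 : swapOn (i + 1) (t i) (t (i + 1)) t (i + 1 + 1) = t (i + 1 + 1) := by
    simp [swapOn]
  rw [h1, h2]
  grind

/-- The factor `p_i p_{i+1/2}` resets column `i` to the colour of column `i+1`, so the exchange made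
by `L_i` remains only in columns `1, …, i-1`. -/
theorem pHalf_mul_L_mul_p_mul_pHalf {k i : ℕ} (hi : 1 ≤ i) (hk : i + 1 ≤ k) :
    pHalf k i * L k i * p k i * pHalf k i = (z k - LHalf k (i - 1)) * pHalf k i := by
  obtain ⟨m, rfl⟩ := Nat.exists_eq_add_of_le' hi
  refine eq_of_action_eq fun n => LinearMap.ext fun F => funext fun t => ?_
  have h2 : m + 1 ≤ k := Nat.le_of_succ_le hk
  simp only [action_mul, map_sub, Module.End.mul_apply, LinearMap.sub_apply, Pi.sub_apply,
    Nat.add_sub_cancel, action_p hi h2, action_pHalf hi hk, action_L hi h2, action_z,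
    action_LHalf h2, sub_sub_cancel]
  simp [swapOn_apply]
  split_ifs with h
  · refine Finset.sum_congr rfl fun a _ => congrArg F (funext fun j => ?_)
    simp only [swapOn_apply, Function.update_apply]
    grind
  · rfl

theorem LHalf_eq {k i : ℕ} (hi : 1 ≤ i) (hk : i + 1 ≤ k) :
    LHalf k i = -(L k i * pHalf k i) - pHalf k i * L k i + (z k - LHalf k (i - 1)) * pHalf k i
      + s k i * LHalf k (i - 1) * s k i + sigmaHalf k i := by
  rw [← pHalf_mul_L_mul_p_mul_pHalf hi hk]
  obtain ⟨m, rfl⟩ := Nat.exists_eq_add_of_le' hi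
  rfl

end PartitionAlgebra

theorem mainTheorem9 (k i : ℕ) (hi : 1 ≤ i) (hk : i + 1 ≤ k) :
    PartitionAlgebra.p k (i + 1) * PartitionAlgebra.sigma k (i + 1) * PartitionAlgebra.p k (i + 1)
        = PartitionAlgebra.L k i * PartitionAlgebra.p k (i + 1) ∧
    PartitionAlgebra.p k (i + 1) * PartitionAlgebra.sigmaHalf k i * PartitionAlgebra.p k (i + 1)
        = (PartitionAlgebra.z k - PartitionAlgebra.LHalf k (i - 1))
            * PartitionAlgebra.p k (i + 1) ∧
    (i + 2 ≤ k →
      PartitionAlgebra.pHalf k (i + 1) * PartitionAlgebra.sigma k (i + 1)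
          * PartitionAlgebra.pHalf k (i + 1)
        = PartitionAlgebra.pHalf k i * PartitionAlgebra.pHalf k (i + 1)) ∧
    PartitionAlgebra.LHalf k i
        = -(PartitionAlgebra.L k i * PartitionAlgebra.pHalf k i)
          - PartitionAlgebra.pHalf k i * PartitionAlgebra.L k i
          + (PartitionAlgebra.z k - PartitionAlgebra.LHalf k (i - 1)) * PartitionAlgebra.pHalf k i
          + PartitionAlgebra.s k i * PartitionAlgebra.LHalf k (i - 1) * PartitionAlgebra.s k i
          + PartitionAlgebra.sigmaHalf k i :=
  ⟨PartitionAlgebra.p_mul_sigma_mul_p hi hk, PartitionAlgebra.p_mul_sigmaHalf_mul_p hi hk,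
    PartitionAlgebra.pHalf_mul_sigma_mul_pHalf hi, PartitionAlgebra.LHalf_eq hi hk⟩
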